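/- **Setting.** A *Young function* is an even, convex, continuous $M\colon\mathbb R\to\mathbb R$ with $M(t)>0$ for $t>0$, $M(t)/t\to0$ as $t\to0$, $M(t)/t\to\infty$ as $t\to\infty$, of the form $M(t)=\int_0^{|t|}m(\tau)\,d\tau$ with $m\colon[0,\infty)\to[0,\infty)$ nondecreasing, right continuous, $m(t)=0$ if and only if $t=0$, and $m(t)\to\infty$ as $t\to\infty$ (no $\Delta_2$-condition is assumed). Its complementary function is $\bar M(t)=\sup_{\tau\ge0}(\tau|t|-M(\tau))$. For a measure $\mu$, $L_M(\mu)$ is the space of $\mu$-measurable real functions $u$ with $\int M(u/k)\,d\mu<\infty$ for some $k>0$, with the Luxemburg norm $\|u\|_{M,\mu}=\inf\{k>0:\int M(u/k)\,d\mu\le1\}$, and $E_M(\mu)$ is the norm closure in $L_M(\mu)$ of the bounded measurable functions with bounded support of finite $\mu$-measure. For $\Omega\subset\mathbb R^n$ write $L_M(\Omega),E_M(\Omega),\|\cdot\|_{M,\Omega}$ when $\mu$ is Lebesgue measure on $\Omega$, and $L_M,E_M$ when $\Omega=\mathbb R^n$. Let $n\ge1$, $0<s<1$, $d\nu=|x-y|^{-n}dx\,dy$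 on $\mathbb R^{2n}$, and $D^su(x,y)=(u(x)-u(y))/|x-y|^s$. Put $W^sL_M=\{u\in L_M: D^su\in L_M(\nu)\}$. For $\Omega\subset\mathbb R^n$ open and bounded, $W^s_0L_M(\Omega)$ is the closure of $\mathcal D(\Omega)=C_c^\infty(\Omega)$ in $W^sL_M$ for the topology $\sigma(L_M\times L_M(\nu),\,E_{\bar M}\times E_{\bar M}(\nu))$ (via $u\mapsto(u,D^su)$), with the norm $\|u\|_{M,\Omega}+\|D^su\|_{M,\nu}$. The set $\Omega$ has the *segment property* if there are a radius $r>0$, a locally finite covering of $\partial\Omega$ by balls $B_r(x_j)$ with $x_j\in\partial\Omega$, unit vectors $n_j$, and $t^*\in(0,1)$ such that $x\in\bar\Omega\cap B_r(x_j)$ implies $x+\tau n_j\in\Omega$ for all $\tau\in(0,t^*)$. **Theorem.** Let $n\ge1$ and $0<s<1$, let $\Omega\subset\mathbb R^n$ be a bounded open set with the segment property, and let $M$ be any Young function. Then $W^s_0L_M(\Omega)\subset E_M(\Omega)$, and this inclusion is compact: if $(u_k)_{k\in\mathbb N}\subset W^s_0L_M(\Omega)$ is bounded, there exist $u\in E_M(\Omega)$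 and a subsequence $(u_{k_j})$ with $\|u_{k_j}-u\|_{M,\Omega}\to0$ as $j\to\infty$. -/

import Mathlib

open MeasureTheory Set Filter Topology
open scoped ENNReal Distributions

noncomputable section

namespace FracOrlicz

/-- Young functions: even, convex, continuous, positive on `(0, ∞)`, sublinear at `0`, superlinear
at `∞`, and of the form `M t = ∫₀^|t| m` with `m : [0, ∞) → [0, ∞)` nondecreasing,
right continuous, vanishing exactly at `0` and tending to `∞`. No growth condition of
doubling type is required. -/
structure IsYoungFunction (M : ℝ → ℝ) : Prop where
  even : ∀ t, M (-t) = M t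
  convex : ConvexOn ℝ univ M
  continuous : Continuous M
  pos : ∀ t, 0 < t → 0 < M t
  tendsto_zero : Tendsto (fun t => M t / t) (𝓝[≠] 0) (𝓝 0)
  tendsto_atTop : Tendsto (fun t => M t / t) atTop atTop
  exists_density : ∃ m : ℝ → ℝ,
    (∀ t, 0 ≤ t → 0 ≤ m t) ∧
    MonotoneOn m (Ici 0) ∧
    (∀ t, 0 ≤ t → ContinuousWithinAt m (Ici t) t) ∧
    (∀ t, 0 ≤ t → (m t = 0 ↔ t = 0)) ∧
    Tendsto m atTop atTop ∧
    ∀ t, M t = ∫ r in (0 : ℝ)..|t|, m r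

/-- The complementary function `t ↦ sup {τ |t| - M τ : τ ≥ 0}`. -/
def complementary (M : ℝ → ℝ) (t : ℝ) : ℝ :=
  sSup ((fun τ : ℝ => τ * |t| - M τ) '' Ici 0)

section Orlicz

variable {α : Type*} [MeasurableSpace α]

/-- The modular `∫ M(f) dμ`, as an extended nonnegative number. -/
def modular (M : ℝ → ℝ) (μ : Measure α) (f : α → ℝ) : ℝ≥0∞ :=
  ∫⁻ x, ENNReal.ofReal (M (f x)) ∂μ

/-- Membership in the Orlicz space `L_M(μ)`. -/
def MemL (M : ℝ → ℝ) (μ : Measure α) (f : α → ℝ) : Prop :=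
  AEMeasurable f μ ∧ ∃ k : ℝ, 0 < k ∧ modular M μ (fun x => f x / k) < ∞

/-- The Luxemburg norm. It is meaningful for `f` in `L_M(μ)`, and only used there. -/
def luxNorm (M : ℝ → ℝ) (μ : Measure α) (f : α → ℝ) : ℝ :=
  sInf {k : ℝ | 0 < k ∧ modular M μ (fun x => f x / k) ≤ 1}

/-- Membership in `E_M(μ)`, the norm closure in `L_M(μ)` of the bounded measurable functions with
bounded support of finite measure. (If `μ` is finite on bounded sets, finiteness of the measure
of the support is automatic. Such functions always belong to `L_M(μ)`.) -/
def MemE [Bornology α] (M : ℝ → ℝ) (μ : Measure α) (f : α → ℝ) : Prop :=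
  MemL M μ f ∧ ∀ ε : ℝ, 0 < ε → ∃ g : α → ℝ,
    AEMeasurable g μ ∧ (∃ C : ℝ, ∀ x, |g x| ≤ C) ∧
    Bornology.IsBounded (Function.support g) ∧ μ (Function.support g) < ∞ ∧
    luxNorm M μ (fun x => f x - g x) < ε

end Orlicz

/-- The measure `dν = dx dy / |x - y|ⁿ` on `ℝⁿ × ℝⁿ`. -/
def nu (n : ℕ) : Measure (EuclideanSpace ℝ (Fin n) × EuclideanSpace ℝ (Fin n)) :=
  volume.withDensity fun p => ENNReal.ofReal (1 / ‖p.1 - p.2‖ ^ n)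

/-- The Hölder quotient `Dˢu(x, y) = (u(x) - u(y)) / |x - y|ˢ`. -/
def holderQuot {n : ℕ} (s : ℝ) (u : EuclideanSpace ℝ (Fin n) → ℝ)
    (p : EuclideanSpace ℝ (Fin n) × EuclideanSpace ℝ (Fin n)) : ℝ :=
  (u p.1 - u p.2) / ‖p.1 - p.2‖ ^ s

/-- The fractional Orlicz-Sobolev space `WˢL_M` on `ℝⁿ`. -/
def WL (n : ℕ) (s : ℝ) (M : ℝ → ℝ) : Set (EuclideanSpace ℝ (Fin n) → ℝ) :=
  {u | MemL M volume u ∧ MemL M (nu n) (holderQuot s u)}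

/-- The pairs `(g, G)` in `E_N × E_N(ν)`, which serve as functionals on `WˢL_M` when `N` is the
complementary function of `M`. -/
def DualPairs (n : ℕ) (N : ℝ → ℝ) :
    Set ((EuclideanSpace ℝ (Fin n) → ℝ) ×
      (EuclideanSpace ℝ (Fin n) × EuclideanSpace ℝ (Fin n) → ℝ)) :=
  {q | MemE N volume q.1 ∧ MemE N (nu n) q.2}

/-- The pairing `∫ u g dx + ∬ Dˢu G dν`. -/
def pairing {n : ℕ} (s : ℝ) (u : EuclideanSpace ℝ (Fin n) → ℝ)
    (q : (EuclideanSpace ℝ (Fin n) → ℝ) ×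
      (EuclideanSpace ℝ (Fin n) × EuclideanSpace ℝ (Fin n) → ℝ)) : ℝ :=
  (∫ x, u x * q.1 x) + ∫ p, holderQuot s u p * q.2 p ∂(nu n)

/-- With `N` the complementary function of `M`, the weak topology `σ(L_M × L_M(ν), E_N × E_N(ν))`
on `WˢL_M`, through `u ↦ (u, Dˢu)`: the coarsest topology for which all the functionals
`u ↦ ∫ u g dx + ∬ Dˢu G dν` are continuous. -/
abbrev weakTop (n : ℕ) (s : ℝ) (M : ℝ → ℝ) : TopologicalSpace (WL n s M) :=
  TopologicalSpace.induced
    (fun (u : WL n s M) (q : DualPairs n (complementary M)) => pairing s u.1 q.1)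
    Pi.topologicalSpace

/-- The space `W₀ˢL_M(Ω)`: the weak closure in `WˢL_M` of the test functions on `Ω`. -/
def W0L {n : ℕ} (s : ℝ) (M : ℝ → ℝ) (Ω : TopologicalSpace.Opens (EuclideanSpace ℝ (Fin n))) :
    Set (EuclideanSpace ℝ (Fin n) → ℝ) :=
  Subtype.val '' (@closure (WL n s M) (weakTop n s M) {v | ∃ φ : 𝓓(Ω, ℝ), v.1 = φ})

/-- The norm `‖u‖_{M,Ω} + ‖Dˢu‖_{M,ν}` of `W₀ˢL_M(Ω)`. -/
def normW0 {n : ℕ} (s : ℝ) (M : ℝ → ℝ) (Ω : Set (EuclideanSpace ℝ (Fin n)))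
    (u : EuclideanSpace ℝ (Fin n) → ℝ) : ℝ :=
  luxNorm M (volume.restrict Ω) u + luxNorm M (nu n) (holderQuot s u)

/-- The segment property: a locally finite covering of the boundary by balls of one
radius `r` with centres on the boundary, such that near each of them the segments starting in the
closure of `Ω` in a suitable fixed direction immediately enter `Ω`, for a uniform length. -/
def SegmentProperty {n : ℕ} (Ω : Set (EuclideanSpace ℝ (Fin n))) : Prop :=
  ∃ (ι : Type) (r t₀ : ℝ) (c e : ι → EuclideanSpace ℝ (Fin n)),
    0 < r ∧ 0 < t₀ ∧ t₀ < 1 ∧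
    (∀ j, c j ∈ frontier Ω) ∧ (∀ j, ‖e j‖ = 1) ∧
    LocallyFinite (fun j => Metric.ball (c j) r) ∧
    frontier Ω ⊆ ⋃ j, Metric.ball (c j) r ∧
    ∀ j, ∀ x ∈ closure Ω ∩ Metric.ball (c j) r, ∀ t ∈ Ioo 0 t₀, x + t • e j ∈ Ω

end FracOrlicz

end

/-! Averaging `u` over the cells of a cubic grid of side `ε` is a norm approximation whose error is
controlled by `Dˢu` alone. Two points of a cell are at distance at most `√n ε`, so there `(u(x) -
u(y)) / l` is at most `(√n ε)ˢ K / l` times `Dˢu / K` in absolute value. Jensen's inequality and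
convexity, in the form `M(θt) ≤ θ M(t)`, bound the modular of the error at scale `l` by a constant
times `(√n ε)ˢ K / l` times the modular of `Dˢu / K` (`modular_sub_gridAverage_le`). The small
factor is taken outside `M`, so no doubling condition enters. The choice of `ε` depends on `K` and
`l`, not on `u`.

The averages are bounded by `ε⁻ⁿ` times the `L¹` norm, because elements of `W₀ˢL_M(Ω)` vanish a.e.
off `Ω` (`ae_eq_zero_of_mem_W0L`) and `L_M ⊂ L¹` on finite measure. This already gives the inclusion
in `E_M(Ω)`. For compactness, a diagonal argument makes the averages on the countably many cells of
all grids `(m + 1)⁻¹ ℤⁿ` converge; dominated convergence and uniform approximation then make the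
subsequence Cauchy (`exists_cauchy_subseq`), and `L_M(Ω)` is complete (`exists_limit`).

Norm smallness is handled throughout as "the modular of `f / l` is at most 1". -/

namespace FracOrlicz

/-! ### Elementary inequalities for Young functions. -/

namespace IsYoungFunction

variable {M : ℝ → ℝ}

lemma map_zero (hM : IsYoungFunction M) : M 0 = 0 := by
  obtain ⟨m, -, -, -, -, -, h⟩ := hM.exists_density
  simpa using h 0

lemma map_abs (hM : IsYoungFunction M) (t : ℝ) : M |t| = M t := by
  rcases abs_choice t with h | h <;> rw [h]
  exact hM.even t

lemma nonneg (hM : IsYoungFunction M) (t : ℝ) : 0 ≤ M t := by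
  rw [← hM.map_abs]
  rcases (abs_nonneg t).eq_or_lt with h | h
  · rw [← h, hM.map_zero]
  · exact (hM.pos _ h).le

/-- Convexity between `t` and `0`. This is the only scaling inequality available without a doubling
condition. -/
lemma map_mul_le (hM : IsYoungFunction M) {θ : ℝ} (h0 : 0 ≤ θ) (h1 : θ ≤ 1) (t : ℝ) :
    M (θ * t) ≤ θ * M t := by
  have h := hM.convex.2 (mem_univ t) (mem_univ (0 : ℝ)) h0 (sub_nonneg.2 h1) (by ring)
  simpa [hM.map_zero] using h

lemma map_mul_le_of_le (hM : IsYoungFunction M) {θ κ : ℝ} (h0 : 0 ≤ θ) (h1 : θ ≤ κ) (h2 : κ ≤ 1)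
    (t : ℝ) : M (θ * t) ≤ κ * M t :=
  (hM.map_mul_le h0 (h1.trans h2) t).trans (mul_le_mul_of_nonneg_right h1 (hM.nonneg t))

lemma mono_abs (hM : IsYoungFunction M) {a b : ℝ} (h : |a| ≤ |b|) : M a ≤ M b := by
  rcases eq_or_ne b 0 with rfl | hb
  · have : a = 0 := by simpa using h
    rw [this]
  · have hb' : 0 < |b| := abs_pos.2 hb
    have := hM.map_mul_le_of_le (θ := |a| / |b|) (κ := 1) (by positivity)
      ((div_le_one hb').2 h) le_rfl |b|
    rwa [div_mul_cancel₀ _ hb'.ne', hM.map_abs, hM.map_abs, one_mul] at this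

/-- Superlinearity at infinity. It gives `L_M ⊂ L¹` on finite measure and bounds the complementary
function on `[-1, 1]`. -/
lemma exists_abs_le_add (hM : IsYoungFunction M) : ∃ T : ℝ, 0 ≤ T ∧ ∀ t, |t| ≤ T + M t := by
  obtain ⟨T, hT⟩ := eventually_atTop.1 (Filter.tendsto_atTop.1 hM.tendsto_atTop 1)
  refine ⟨max T 1, by positivity, fun t => ?_⟩
  rcases le_total |t| (max T 1) with h | h
  · linarith [hM.nonneg t]
  · have h1 := hT |t| ((le_max_left _ _).trans h)
    have h2 : 0 < |t| := one_pos.trans_le ((le_max_right _ _).trans h)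
    rw [le_div_iff₀ h2, hM.map_abs, one_mul] at h1
    linarith [le_max_right T 1]

lemma map_add_div_le (hM : IsYoungFunction M) {a b : ℝ} (ha : 0 < a) (hb : 0 < b) (x y : ℝ) :
    M ((x + y) / (a + b)) ≤ a / (a + b) * M (x / a) + b / (a + b) * M (y / b) := by
  have h := hM.convex.2 (mem_univ (x / a)) (mem_univ (y / b)) (div_pos ha (add_pos ha hb)).le
    (div_pos hb (add_pos ha hb)).le (by field_simp)
  have e : (a / (a + b)) • (x / a) + (b / (a + b)) • (y / b) = (x + y) / (a + b) := by
    simp only [smul_eq_mul]; field_simp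
  rwa [e] at h

end IsYoungFunction

/-! ### Modulars, the Luxemburg norm and Jensen's inequality. -/

section Modular

variable {α : Type*} [MeasurableSpace α] {μ : Measure α} {M : ℝ → ℝ} {f g : α → ℝ}

lemma modular_congr_ae (h : f =ᵐ[μ] g) : modular M μ f = modular M μ g :=
  lintegral_congr_ae (h.mono fun x hx => by simp only [hx])

lemma modular_restrict_le (s : Set α) : modular M (μ.restrict s) f ≤ modular M μ f :=
  lintegral_mono' Measure.restrict_le_self le_rfl

lemma MemL.restrict (h : MemL M μ f) (s : Set α) : MemL M (μ.restrict s) f :=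
  ⟨h.1.restrict, h.2.imp fun _ hk => ⟨hk.1, (modular_restrict_le s).trans_lt hk.2⟩⟩

lemma luxNorm_nonneg : 0 ≤ luxNorm M μ f := Real.sInf_nonneg fun _ hk => hk.1.le

lemma luxNorm_le {k : ℝ} (hk : 0 < k) (h : modular M μ (fun x => f x / k) ≤ 1) :
    luxNorm M μ f ≤ k :=
  csInf_le ⟨0, fun _ hk => hk.1.le⟩ ⟨hk, h⟩

namespace IsYoungFunction

lemma modular_anti (hM : IsYoungFunction M) {a b : ℝ} (ha : 0 < a) (hab : a ≤ b) :
    modular M μ (fun x => f x / b) ≤ modular M μ (fun x => f x / a) := by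
  refine lintegral_mono fun x => ENNReal.ofReal_le_ofReal (hM.mono_abs ?_)
  rw [abs_div, abs_div, abs_of_pos ha, abs_of_pos (ha.trans_le hab)]
  gcongr

/-- If the modular at scale `k` is `A`, enlarging the scale by `A + 1` divides it by at least `A +
1`. Hence the infimum defining the norm runs over a nonempty set. -/
lemma exists_modular_le_one (hM : IsYoungFunction M) (hf : MemL M μ f) :
    ∃ k : ℝ, 0 < k ∧ modular M μ (fun x => f x / k) ≤ 1 := by
  obtain ⟨k, hk, h⟩ := hf.2
  set A := (modular M μ fun x => f x / k).toReal with hA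
  have hA0 : 0 ≤ A := ENNReal.toReal_nonneg
  refine ⟨k * (A + 1), by positivity, ?_⟩
  calc modular M μ (fun x => f x / (k * (A + 1)))
      ≤ ∫⁻ x, ENNReal.ofReal (A + 1)⁻¹ * ENNReal.ofReal (M (f x / k)) ∂μ := by
        refine lintegral_mono fun x => ?_
        rw [← ENNReal.ofReal_mul (by positivity)]
        refine ENNReal.ofReal_le_ofReal ?_
        have := hM.map_mul_le (θ := (A + 1)⁻¹) (by positivity)
          (inv_le_one_of_one_le₀ (by linarith)) (f x / k)
        convert this using 2
        field_simp
    _ = ENNReal.ofReal (A + 1)⁻¹ * ENNReal.ofReal A := by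
        rw [lintegral_const_mul' _ _ ENNReal.ofReal_ne_top, hA, ENNReal.ofReal_toReal h.ne]
        rfl
    _ ≤ 1 := by
        rw [← ENNReal.ofReal_mul (by positivity), ENNReal.ofReal_le_one, inv_mul_le_iff₀]
        · linarith
        · positivity

lemma modular_le_one_of_luxNorm_lt (hM : IsYoungFunction M) (hf : MemL M μ f) {k : ℝ}
    (h : luxNorm M μ f < k) : modular M μ (fun x => f x / k) ≤ 1 := by
  obtain ⟨a, ⟨ha, ha'⟩, hak⟩ := exists_lt_of_csInf_lt (hM.exists_modular_le_one hf) h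
  exact (hM.modular_anti ha hak.le).trans ha'

lemma aemeasurable_comp (hM : IsYoungFunction M) (hf : AEMeasurable f μ) :
    AEMeasurable (fun x => ENNReal.ofReal (M (f x))) μ :=
  (hM.continuous.measurable.comp_aemeasurable hf).ennreal_ofReal

/-- The triangle inequality at the level of modulars: `(f + g) / (a + b)` is the convex combination
of `f / a` and `g / b` with weights proportional to `a` and `b`. -/
lemma modular_add_le_one (hM : IsYoungFunction M) (hf : AEMeasurable f μ) {a b : ℝ} (ha : 0 < a)
    (hb : 0 < b) (h1 : modular M μ (fun x => f x / a) ≤ 1)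
    (h2 : modular M μ (fun x => g x / b) ≤ 1) :
    modular M μ (fun x => (f x + g x) / (a + b)) ≤ 1 := by
  calc modular M μ (fun x => (f x + g x) / (a + b))
      ≤ ∫⁻ x, (ENNReal.ofReal (a / (a + b)) * ENNReal.ofReal (M (f x / a)) +
          ENNReal.ofReal (b / (a + b)) * ENNReal.ofReal (M (g x / b))) ∂μ := by
        refine lintegral_mono fun x => ?_
        rw [← ENNReal.ofReal_mul (by positivity), ← ENNReal.ofReal_mul (by positivity),
          ← ENNReal.ofReal_add (mul_nonneg (by positivity) (hM.nonneg _))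
            (mul_nonneg (by positivity) (hM.nonneg _))]
        exact ENNReal.ofReal_le_ofReal (hM.map_add_div_le ha hb _ _)
    _ = ENNReal.ofReal (a / (a + b)) * modular M μ (fun x => f x / a) +
          ENNReal.ofReal (b / (a + b)) * modular M μ (fun x => g x / b) := by
        rw [lintegral_add_left' ((hM.aemeasurable_comp (hf.div_const a)).const_mul _),
          lintegral_const_mul' _ _ ENNReal.ofReal_ne_top,
          lintegral_const_mul' _ _ ENNReal.ofReal_ne_top]
        rfl
    _ ≤ ENNReal.ofReal (a / (a + b)) * 1 + ENNReal.ofReal (b / (a + b)) * 1 := by gcongr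
    _ = 1 := by
        rw [mul_one, mul_one, ← ENNReal.ofReal_add (by positivity) (by positivity),
          ← add_div, div_self (by positivity), ENNReal.ofReal_one]

lemma modular_sub_le_one (hM : IsYoungFunction M) (hf : AEMeasurable f μ) {a b : ℝ} (ha : 0 < a)
    (hb : 0 < b) (h1 : modular M μ (fun x => f x / a) ≤ 1)
    (h2 : modular M μ (fun x => g x / b) ≤ 1) :
    modular M μ (fun x => (f x - g x) / (a + b)) ≤ 1 := by
  simp only [sub_eq_add_neg]
  refine hM.modular_add_le_one hf ha hb h1 (le_of_eq_of_le ?_ h2)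
  simp only [modular, neg_div, hM.even]

lemma lintegral_enorm_le (hM : IsYoungFunction M) {T : ℝ} (hT0 : 0 ≤ T)
    (hT : ∀ t, |t| ≤ T + M t) {k : ℝ} (hk : 0 < k) (h : modular M μ (fun x => f x / k) ≤ 1) :
    ∫⁻ x, ‖f x‖ₑ ∂μ ≤ ENNReal.ofReal k * (ENNReal.ofReal T * μ univ + 1) := by
  calc ∫⁻ x, ‖f x‖ₑ ∂μ
      ≤ ∫⁻ x, ENNReal.ofReal k * (ENNReal.ofReal T + ENNReal.ofReal (M (f x / k))) ∂μ := by
        refine lintegral_mono fun x => ?_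
        rw [← ENNReal.ofReal_add hT0 (hM.nonneg _), ← ENNReal.ofReal_mul hk.le,
          ← ofReal_norm, Real.norm_eq_abs]
        refine ENNReal.ofReal_le_ofReal ?_
        have := hT (f x / k)
        rwa [abs_div, abs_of_pos hk, div_le_iff₀' hk] at this
    _ = ENNReal.ofReal k * (ENNReal.ofReal T * μ univ + modular M μ (fun x => f x / k)) := by
        rw [lintegral_const_mul' _ _ ENNReal.ofReal_ne_top, lintegral_add_left measurable_const,
          lintegral_const]
        rfl
    _ ≤ _ := by gcongr

lemma integrable_of_memL (hM : IsYoungFunction M) [IsFiniteMeasure μ] (hf : MemL M μ f) :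
    Integrable f μ := by
  obtain ⟨k, hk, h⟩ := hM.exists_modular_le_one hf
  obtain ⟨T, hT0, hT⟩ := hM.exists_abs_le_add
  refine ⟨hf.1.aestronglyMeasurable, (hM.lintegral_enorm_le hT0 hT hk h).trans_lt ?_⟩
  exact ENNReal.mul_lt_top ENNReal.ofReal_lt_top (ENNReal.add_lt_top.2
    ⟨ENNReal.mul_lt_top ENNReal.ofReal_lt_top (measure_lt_top _ _), ENNReal.one_lt_top⟩)

/-- Jensen's inequality for `ENNReal`-valued averages, without integrability of `M ∘ f`. -/
lemma ofReal_map_average_le (hM : IsYoungFunction M) {s : Set α} (h0 : μ s ≠ 0) (h1 : μ s ≠ ∞)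
    (hf : IntegrableOn f s μ) :
    ENNReal.ofReal (M (⨍ x in s, f x ∂μ)) ≤
      (μ s)⁻¹ * ∫⁻ x in s, ENNReal.ofReal (M (f x)) ∂μ := by
  -- An infinite right-hand side is trivial; a finite one makes `M ∘ f` integrable, so that Jensen's
  -- inequality for Bochner integrals applies.
  rcases eq_or_ne (∫⁻ x in s, ENNReal.ofReal (M (f x)) ∂μ) ∞ with h | h
  · rw [h, ENNReal.mul_top (ENNReal.inv_ne_zero.2 h1)]
    exact le_top
  have hm : AEStronglyMeasurable (fun x => M (f x)) (μ.restrict s) :=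
    hM.continuous.comp_aestronglyMeasurable hf.1
  have hi : IntegrableOn (fun x => M (f x)) s μ :=
    (lintegral_ofReal_ne_top_iff_integrable hm (ae_of_all _ fun x => hM.nonneg _)).1 h
  have hJ := hM.convex.map_set_average_le hM.continuous.continuousOn isClosed_univ h0 h1
    (ae_of_all _ fun _ => mem_univ _) hf hi
  refine (ENNReal.ofReal_le_ofReal hJ).trans ?_
  rw [setAverage_eq, smul_eq_mul, ENNReal.ofReal_mul (by positivity),
    ofReal_integral_eq_lintegral_ofReal hi (ae_of_all _ fun x => hM.nonneg _), measureReal_def,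
    ← ENNReal.toReal_inv, ENNReal.ofReal_toReal (ENNReal.inv_ne_top.2 h0)]

end IsYoungFunction

end Modular

end FracOrlicz

/-! ### Bounded functions in `E_N`, and vanishing outside `Ω`. -/

namespace FracOrlicz

lemma luxNorm_zero {α : Type*} [MeasurableSpace α] {μ : Measure α} {M : ℝ → ℝ} (h : M 0 = 0) :
    luxNorm M μ (fun _ => 0) = 0 := by
  refine le_antisymm (le_of_forall_pos_le_add fun ε hε => ?_) luxNorm_nonneg
  rw [zero_add]
  exact luxNorm_le hε (by simp [modular, h])

/-- Bounded functions with bounded support of finite measure are in `E_N`, for any `N` that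
vanishes at `0` and is bounded on bounded sets. -/
lemma memE_of_bounded {α : Type*} [MeasurableSpace α] [Bornology α] {μ : Measure α} {N : ℝ → ℝ}
    (h0 : N 0 = 0) {g : α → ℝ} (hg : AEMeasurable g μ) {C B : ℝ} (hC : ∀ x, |g x| ≤ C)
    (hB : ∀ t, |t| ≤ C → N t ≤ B) {S : Set α} (hS : MeasurableSet S)
    (hgS : Function.support g ⊆ S) (hSb : Bornology.IsBounded S) (hSμ : μ S < ∞) :
    MemE N μ g := by
  refine ⟨⟨hg, 1, one_pos, ?_⟩, fun ε hε =>
    ⟨g, hg, ⟨C, hC⟩, hSb.subset hgS, (measure_mono hgS).trans_lt hSμ, ?_⟩⟩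
  · calc modular N μ (fun x => g x / 1)
        ≤ ∫⁻ x, S.indicator (fun _ => ENNReal.ofReal B) x ∂μ := by
          refine lintegral_mono fun x => ?_
          by_cases hx : x ∈ S
          · simp only [indicator_of_mem hx, div_one]
            exact ENNReal.ofReal_le_ofReal (hB _ (hC x))
          · have : g x = 0 := by
              by_contra h
              exact hx (hgS h)
            simp [this, h0]
      _ = ENNReal.ofReal B * μ S := lintegral_indicator_const hS _
      _ < ∞ := ENNReal.mul_lt_top ENNReal.ofReal_lt_top hSμ
  · simpa [luxNorm_zero h0] using hε

/-- For `τ ≥ 0` one has `τ|t| ≤ τ ≤ T + M(τ)`. This puts bounded test functions such as signs into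
the dual class. -/
lemma complementary_le_of_abs_le_one {M : ℝ → ℝ} {T : ℝ}
    (hT : ∀ t, |t| ≤ T + M t) {t : ℝ} (ht : |t| ≤ 1) : complementary M t ≤ T := by
  refine csSup_le ⟨_, mem_image_of_mem _ (mem_Ici.2 le_rfl)⟩ ?_
  rintro _ ⟨τ, hτ, rfl⟩
  have h1 : τ * |t| ≤ τ := mul_le_of_le_one_right hτ ht
  have h2 := (le_abs_self τ).trans (hT τ)
  simp only
  linarith

namespace IsYoungFunction

variable {M : ℝ → ℝ}

lemma complementary_zero (hM : IsYoungFunction M) : complementary M 0 = 0 := by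
  unfold complementary
  refine le_antisymm (csSup_le ⟨_, mem_image_of_mem _ (mem_Ici.2 le_rfl)⟩ ?_) ?_
  · rintro _ ⟨τ, -, rfl⟩
    simpa using hM.nonneg τ
  · refine le_csSup ⟨0, ?_⟩ ⟨0, mem_Ici.2 le_rfl, by simp [hM.map_zero]⟩
    rintro _ ⟨τ, -, rfl⟩
    simpa using hM.nonneg τ

lemma integrableOn_of_memL {α : Type*} [MeasurableSpace α] {μ : Measure α}
    (hM : IsYoungFunction M) {f : α → ℝ} (hf : MemL M μ f) {s : Set α} (hs : μ s ≠ ∞) :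
    IntegrableOn f s μ := by
  have : IsFiniteMeasure (μ.restrict s) := ⟨by simpa using hs.lt_top⟩
  exact hM.integrable_of_memL (hf.restrict s)

end IsYoungFunction

section Support

variable {n : ℕ} {s : ℝ} {M : ℝ → ℝ} {Ω : TopologicalSpace.Opens (EuclideanSpace ℝ (Fin n))}
  {u : EuclideanSpace ℝ (Fin n) → ℝ}

lemma mem_WL_of_mem_W0L (hu : u ∈ W0L s M Ω) : u ∈ WL n s M := by
  obtain ⟨v, -, rfl⟩ := hu
  exact v.2

/-- A functional of the dual pair that vanishes on the test functions vanishes on `W₀ˢL_M(Ω)`. -/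
lemma pairing_eq_zero_of_mem_W0L (hu : u ∈ W0L s M Ω)
    {q : (EuclideanSpace ℝ (Fin n) → ℝ) ×
      (EuclideanSpace ℝ (Fin n) × EuclideanSpace ℝ (Fin n) → ℝ)}
    (hq : q ∈ DualPairs n (complementary M)) (h : ∀ φ : 𝓓(Ω, ℝ), pairing s φ q = 0) :
    pairing s u q = 0 := by
  obtain ⟨v, hv, rfl⟩ := hu
  let _ := weakTop n s M
  have hc : Continuous fun w : WL n s M => pairing s w.1 q :=
    (continuous_apply (A := fun _ => ℝ) (⟨q, hq⟩ : DualPairs n (complementary M))).comp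
      (continuous_induced_dom
        (f := fun (w : WL n s M) (q : DualPairs n (complementary M)) => pairing s w.1 q.1))
  refine closure_minimal ?_ (isClosed_singleton.preimage hc) hv
  rintro w ⟨φ, hφ⟩
  simp only [mem_preimage, mem_singleton_iff]
  rw [hφ]
  exact h φ

/-- The sign of `u`, cut off to a bounded set disjoint from `Ω`, is an admissible functional killing
all test functions, hence killing `u`; its value at `u` is the integral of `|u|` over that set. -/
lemma ae_eq_zero_of_mem_W0L (hM : IsYoungFunction M) (hu : u ∈ W0L s M Ω) :
    ∀ᵐ x ∂(volume : Measure (EuclideanSpace ℝ (Fin n))),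
      x ∉ (Ω : Set (EuclideanSpace ℝ (Fin n))) → u x = 0 := by
  have huL : MemL M volume u := (mem_WL_of_mem_W0L hu).1
  -- Cutting with balls gives the test function bounded support of finite measure, as `E_N`
  -- requires.
  suffices H : ∀ R : ℕ, ∀ᵐ x ∂(volume : Measure (EuclideanSpace ℝ (Fin n))),
      x ∈ Metric.ball 0 R \ (Ω : Set (EuclideanSpace ℝ (Fin n))) → u x = 0 by
    filter_upwards [ae_all_iff.2 H] with x hx hxΩ
    obtain ⟨R, hR⟩ := exists_nat_gt ‖x‖
    exact hx R ⟨by simpa using hR, hxΩ⟩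
  intro R
  set S : Set (EuclideanSpace ℝ (Fin n)) := Metric.ball 0 R \ (Ω : Set _) with hS
  have hSm : MeasurableSet S := measurableSet_ball.diff Ω.isOpen.measurableSet
  have hSb : Bornology.IsBounded S := Metric.isBounded_ball.subset sdiff_subset
  have hSv : volume S < ∞ := hSb.measure_lt_top
  obtain ⟨T, hT0, hT⟩ := hM.exists_abs_le_add
  -- The value at `0` is immaterial, since the sign is only multiplied by `t`.
  set sgn : ℝ → ℝ := fun t => if 0 ≤ t then 1 else -1 with hsgn
  have hsgn_meas : Measurable sgn := Measurable.ite measurableSet_Ici measurable_const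
    measurable_const
  have hsgn_abs : ∀ t, |sgn t| = 1 := fun t => by
    simp only [hsgn]; split_ifs <;> simp
  have hsgn_mul : ∀ t, t * sgn t = |t| := fun t => by
    simp only [hsgn]; split_ifs with h
    · rw [mul_one, abs_of_nonneg h]
    · rw [mul_neg_one, abs_of_neg (not_le.1 h)]
  set g : EuclideanSpace ℝ (Fin n) → ℝ := S.indicator fun x => sgn (u x) with hg
  have hgE : MemE (complementary M) volume g :=
    memE_of_bounded hM.complementary_zero
      ((hsgn_meas.comp_aemeasurable huL.1).indicator hSm) (C := 1)
      (fun x => by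
        by_cases hx : x ∈ S
        · simp [hg, hx, hsgn_abs]
        · simp [hg, hx])
      (fun t ht => complementary_le_of_abs_le_one hT ht) hSm support_indicator_subset hSb hSv
  have h0E : MemE (complementary M) (nu n) 0 :=
    memE_of_bounded hM.complementary_zero aemeasurable_const (C := 1) (fun x => by simp)
      (fun t ht => complementary_le_of_abs_le_one hT ht) MeasurableSet.empty
      (by simp) Bornology.isBounded_empty (by simp)
  have hz := pairing_eq_zero_of_mem_W0L hu (q := (g, 0)) ⟨hgE, h0E⟩ fun φ => by
    have : ∀ x, φ x * g x = 0 := fun x => by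
      by_cases hx : x ∈ S
      · have : φ x = 0 := by
          by_contra h
          exact hx.2 (φ.tsupport_subset (subset_tsupport _ h))
        rw [this, zero_mul]
      · simp [hg, hx]
    simp [pairing, this]
  have hint : ∫ x in S, |u x| = 0 := by
    rw [← integral_indicator hSm, ← hz]
    simp only [pairing, Pi.zero_apply, mul_zero, integral_zero, add_zero]
    congr 1 with x
    by_cases hx : x ∈ S
    · simp [hg, hx, hsgn_mul]
    · simp [hg, hx]
  have hui : IntegrableOn u S := hM.integrableOn_of_memL huL hSv.ne
  have := (integral_eq_zero_iff_of_nonneg (fun x => abs_nonneg (u x)) hui.abs).1 hint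
  rw [EventuallyEq, ae_restrict_iff' hSm] at this
  filter_upwards [this] with x hx hxS
  simpa using hx hxS

end Support

end FracOrlicz

namespace FracOrlicz

/-! ### Cubic grids and averages over their cells. -/

section Grid

variable {n : ℕ} {ε : ℝ}

/-- The index of the cell of the grid `ε ℤⁿ` that contains a point. -/
noncomputable def gridIndex (ε : ℝ) (x : EuclideanSpace ℝ (Fin n)) : Fin n → ℤ := fun i => ⌊x i / ε⌋

/-- The half-open cubes of side `ε` with vertices in `ε ℤⁿ`. -/
def gridCell (ε : ℝ) (z : Fin n → ℤ) : Set (EuclideanSpace ℝ (Fin n)) := gridIndex ε ⁻¹' {z}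

/-- The function that replaces `u` by its average on each cell of the grid `ε ℤⁿ`. -/
noncomputable def gridAverage (ε : ℝ) (u : EuclideanSpace ℝ (Fin n) → ℝ) (x : EuclideanSpace ℝ (Fin n)) : ℝ :=
  ⨍ y in gridCell ε (gridIndex ε x), u y

lemma measurable_gridIndex : Measurable (gridIndex (n := n) ε) :=
  measurable_pi_lambda _ fun i => by
    have : Measurable fun x : EuclideanSpace ℝ (Fin n) => x i := by fun_prop
    exact (this.div_const ε).floor

lemma measurableSet_gridCell (z : Fin n → ℤ) : MeasurableSet (gridCell ε z) :=
  measurable_gridIndex (measurableSet_singleton z)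

lemma pairwise_disjoint_gridCell : Pairwise (Function.onFun Disjoint (gridCell (n := n) ε)) :=
  fun _ _ h => (disjoint_singleton.2 h).preimage _

lemma iUnion_gridCell : ⋃ z, gridCell (n := n) ε z = univ :=
  eq_univ_of_forall fun x => mem_iUnion.2 ⟨gridIndex ε x, rfl⟩

lemma measurable_gridAverage (u : EuclideanSpace ℝ (Fin n) → ℝ) : Measurable (gridAverage ε u) :=
  (measurable_of_countable fun z : Fin n → ℤ => ⨍ y in gridCell ε z, u y).comp
    measurable_gridIndex

lemma gridAverage_eq {u : EuclideanSpace ℝ (Fin n) → ℝ} {z : Fin n → ℤ}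
    {x : EuclideanSpace ℝ (Fin n)} (hx : x ∈ gridCell ε z) :
    gridAverage ε u x = ⨍ y in gridCell ε z, u y := by
  have : gridIndex ε x = z := hx
  rw [gridAverage, this]

lemma volume_gridCell (hε : 0 < ε) (z : Fin n → ℤ) :
    volume (gridCell ε z) = ENNReal.ofReal (ε ^ n) := by
  have h : gridCell ε z = (MeasurableEquiv.toLp 2 (Fin n → ℝ)).symm ⁻¹'
      (univ.pi fun i => Ico (z i * ε) ((z i + 1) * ε)) := by
    ext x
    simp only [gridCell, mem_preimage, mem_singleton_iff, funext_iff, gridIndex, Int.floor_eq_iff,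
      Set.mem_pi, mem_univ, true_imp_iff, mem_Ico, le_div_iff₀ hε, div_lt_iff₀ hε]
    rfl
  rw [h, (EuclideanSpace.volume_preserving_symm_measurableEquiv_toLp (Fin n)).measure_preimage
    (MeasurableSet.univ_pi fun i => measurableSet_Ico).nullMeasurableSet, Real.volume_pi_Ico,
    ENNReal.ofReal_pow hε.le]
  have : ∀ i, ((z i : ℝ) + 1) * ε - z i * ε = ε := fun i => by ring
  simp [this]

lemma norm_sub_le_of_mem_gridCell (hε : 0 < ε) {z : Fin n → ℤ} {x y : EuclideanSpace ℝ (Fin n)}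
    (hx : x ∈ gridCell ε z) (hy : y ∈ gridCell ε z) : ‖x - y‖ ≤ √n * ε := by
  have h : ∀ i, ‖(x - y) i‖ ^ 2 ≤ ε ^ 2 := fun i => by
    have h1 := congrFun hx i
    have h2 := congrFun hy i
    simp only [gridIndex, Int.floor_eq_iff, le_div_iff₀ hε, div_lt_iff₀ hε] at h1 h2
    rw [Real.norm_eq_abs, sq_abs, PiLp.sub_apply]
    refine sq_le_sq' ?_ ?_ <;> nlinarith
  rw [EuclideanSpace.norm_eq, ← Real.sqrt_sq hε.le, ← Real.sqrt_mul (Nat.cast_nonneg n)]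
  refine Real.sqrt_le_sqrt ((Finset.sum_le_sum fun i _ => h i).trans ?_)
  simp

/-- The bound degenerates as `ε → 0`, but for fixed `ε` it depends on `u` only through its `L¹` norm
and is uniform over the cells. -/
lemma abs_setAverage_gridCell_le (hε : 0 < ε) {u : EuclideanSpace ℝ (Fin n) → ℝ}
    (hu : Integrable u) (z : Fin n → ℤ) :
    |⨍ y in gridCell ε z, u y| ≤ (ε ^ n)⁻¹ * ∫ y, |u y| := by
  rw [setAverage_eq, measureReal_def, volume_gridCell hε, ENNReal.toReal_ofReal (by positivity),
    smul_eq_mul, abs_mul, abs_of_pos (by positivity : 0 < (ε ^ n)⁻¹)]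
  gcongr
  exact abs_integral_le_integral_abs.trans
    (setIntegral_le_integral hu.abs (ae_of_all _ fun x => abs_nonneg _))

lemma abs_gridAverage_le (hε : 0 < ε) {u : EuclideanSpace ℝ (Fin n) → ℝ}
    (hu : Integrable u) (x : EuclideanSpace ℝ (Fin n)) :
    |gridAverage ε u x| ≤ (ε ^ n)⁻¹ * ∫ y, |u y| :=
  abs_setAverage_gridCell_le hε hu _

end Grid

/-! ### The approximation estimate for grid averages. -/

namespace IsYoungFunction

variable {n : ℕ} {s ε K l : ℝ} {M : ℝ → ℝ} {u : EuclideanSpace ℝ (Fin n) → ℝ}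

/-- Here `(u(x) - u(y)) / l` is `Dˢu / K` times `|x - y|ˢ K / l`, a factor that convexity takes out
of `M`. The density of `ν` is then inserted at the price of `(√n ε)ⁿ`, as `(√n ε)ⁿ / |x - y|ⁿ ≥ 1`
on a cell. -/
lemma map_sub_div_le (hM : IsYoungFunction M) (hs : 0 < s) (hε : 0 < ε) (hK : 0 < K) (hl : 0 < l)
    (hεl : (√n * ε) ^ s * K / l ≤ 1) {z : Fin n → ℤ} {x y : EuclideanSpace ℝ (Fin n)}
    (hx : x ∈ gridCell ε z) (hy : y ∈ gridCell ε z) :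
    M ((u x - u y) / l) ≤ (√n * ε) ^ n * ((√n * ε) ^ s * K / l) *
      (1 / ‖x - y‖ ^ n * M (holderQuot s u (x, y) / K)) := by
  rcases eq_or_ne x y with rfl | hxy
  · rw [sub_self, zero_div, hM.map_zero]
    have := hM.nonneg (holderQuot s u (x, x) / K)
    positivity
  have hd : 0 < ‖x - y‖ := norm_pos_iff.2 (sub_ne_zero.2 hxy)
  have hle := norm_sub_le_of_mem_gridCell hε hx hy
  have hds : 0 < ‖x - y‖ ^ s := Real.rpow_pos_of_pos hd s
  have h1 := hM.map_mul_le_of_le (θ := ‖x - y‖ ^ s * K / l) (κ := (√n * ε) ^ s * K / l)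
    (by positivity) (by gcongr) hεl (holderQuot s u (x, y) / K)
  have e : ‖x - y‖ ^ s * K / l * (holderQuot s u (x, y) / K) = (u x - u y) / l := by
    simp only [holderQuot]
    field_simp
  rw [e] at h1
  have h2 : 1 ≤ (√n * ε) ^ n * (1 / ‖x - y‖ ^ n) := by
    rw [mul_one_div, le_div_iff₀ (by positivity), one_mul]
    gcongr
  have h3 := mul_le_mul_of_nonneg_right h2
    (mul_nonneg (by positivity : 0 ≤ (√n * ε) ^ s * K / l) (hM.nonneg (holderQuot s u (x, y) / K)))
  rw [one_mul] at h3
  exact h1.trans (h3.trans_eq (by ring))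

lemma aemeasurable_sub_prod (hu : AEMeasurable u) : AEMeasurable
    (fun p : EuclideanSpace ℝ (Fin n) × EuclideanSpace ℝ (Fin n) => u p.1 - u p.2)
    (volume.prod volume) :=
  hu.comp_fst.sub hu.comp_snd

/-- Averaging on a single cell of the grid. -/
lemma lintegral_gridCell_le (hM : IsYoungFunction M) (hs : 0 < s) (hε : 0 < ε) (hK : 0 < K)
    (hl : 0 < l) (hεl : (√n * ε) ^ s * K / l ≤ 1) (hu : AEMeasurable u)
    (hui : ∀ z, IntegrableOn u (gridCell ε z)) (z : Fin n → ℤ) :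
    ∫⁻ x in gridCell ε z, ENNReal.ofReal (M ((u x - gridAverage ε u x) / l)) ≤
      ENNReal.ofReal (√n ^ n * ((√n * ε) ^ s * K / l)) *
        ∫⁻ p in gridCell ε z ×ˢ gridCell ε z,
          ENNReal.ofReal (M (holderQuot s u p / K)) ∂(nu n) := by
  set Q := gridCell (n := n) ε z with hQ
  have hQm : MeasurableSet Q := measurableSet_gridCell z
  have hv : volume Q = ENNReal.ofReal (ε ^ n) := volume_gridCell hε z
  have hv0 : volume Q ≠ 0 := by rw [hv]; simpa using pow_pos hε n
  have hvt : volume Q ≠ ∞ := by rw [hv]; exact ENNReal.ofReal_ne_top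
  have hdens : Measurable fun p : EuclideanSpace ℝ (Fin n) × EuclideanSpace ℝ (Fin n) =>
      ENNReal.ofReal (1 / ‖p.1 - p.2‖ ^ n) := by fun_prop
  calc ∫⁻ x in Q, ENNReal.ofReal (M ((u x - gridAverage ε u x) / l))
      -- For fixed `x`, the error is the average over `y` in the cell of `(u(x) - u(y)) / l`; Jensen
      -- applies in `y`.
      ≤ ∫⁻ x in Q, (volume Q)⁻¹ * ∫⁻ y in Q, ENNReal.ofReal (M ((u x - u y) / l)) := by
        refine setLIntegral_mono' hQm fun x hx => ?_
        have hc : Integrable (fun _ => u x) (volume.restrict Q) := integrableOn_const hvt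
        have hu' : Integrable u (volume.restrict Q) := hui z
        have hav : gridAverage ε u x = ⨍ y in Q, u y := gridAverage_eq hx
        have hf : IntegrableOn (fun y => (u x - u y) / l) Q := (hc.sub hu').div_const l
        refine le_of_eq_of_le ?_ (hM.ofReal_map_average_le hv0 hvt hf)
        rw [hav, setAverage_eq, setAverage_eq, integral_div, integral_sub hc hu',
          setIntegral_const]
        have : volume.real Q ≠ 0 := (ENNReal.toReal_pos hv0 hvt).ne'
        simp only [smul_eq_mul]
        congr 2
        field_simp
    _ = (volume Q)⁻¹ * ∫⁻ p in Q ×ˢ Q, ENNReal.ofReal (M ((u p.1 - u p.2) / l)) := by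
        rw [lintegral_const_mul' _ _ (ENNReal.inv_ne_top.2 hv0), Measure.volume_eq_prod,
          ← Measure.prod_restrict, lintegral_prod]
        rw [Measure.prod_restrict]
        exact hM.aemeasurable_comp ((aemeasurable_sub_prod hu).div_const l).restrict
    _ ≤ (volume Q)⁻¹ * ∫⁻ p in Q ×ˢ Q,
          ENNReal.ofReal ((√n * ε) ^ n * ((√n * ε) ^ s * K / l)) *
            (ENNReal.ofReal (1 / ‖p.1 - p.2‖ ^ n) *
              ENNReal.ofReal (M (holderQuot s u p / K))) := by
        refine mul_le_mul_right (setLIntegral_mono' (hQm.prod hQm) fun p hp => ?_) _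
        rw [← ENNReal.ofReal_mul (by positivity), ← ENNReal.ofReal_mul (by positivity)]
        exact ENNReal.ofReal_le_ofReal (hM.map_sub_div_le hs hε hK hl hεl hp.1 hp.2)
    -- The volume `εⁿ` of the cell cancels the `εⁿ` from the density, so the gain `(√n ε)ˢ`
    -- survives.
    _ = ENNReal.ofReal (√n ^ n * ((√n * ε) ^ s * K / l)) *
          ∫⁻ p in Q ×ˢ Q, ENNReal.ofReal (1 / ‖p.1 - p.2‖ ^ n) *
              ENNReal.ofReal (M (holderQuot s u p / K)) := by
        rw [lintegral_const_mul' _ _ ENNReal.ofReal_ne_top, ← mul_assoc, hv,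
          ← ENNReal.ofReal_inv_of_pos (by positivity), ← ENNReal.ofReal_mul (by positivity)]
        congr 2
        rw [mul_pow]
        field_simp
    _ = _ := by
        rw [nu, setLIntegral_withDensity_eq_setLIntegral_mul_non_measurable _ hdens _
          (hQm.prod hQm) (ae_of_all _ fun _ => ENNReal.ofReal_lt_top)]
        rfl

lemma modular_sub_gridAverage_le (hM : IsYoungFunction M) (hs : 0 < s) (hε : 0 < ε) (hK : 0 < K)
    (hl : 0 < l) (hεl : (√n * ε) ^ s * K / l ≤ 1) (hu : AEMeasurable u)
    (hui : ∀ z, IntegrableOn u (gridCell ε z)) :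
    modular M volume (fun x => (u x - gridAverage ε u x) / l) ≤
      ENNReal.ofReal (√n ^ n * ((√n * ε) ^ s * K / l)) *
        modular M (nu n) (fun p => holderQuot s u p / K) := by
  unfold modular
  rw [← setLIntegral_univ, ← iUnion_gridCell (ε := ε),
    lintegral_iUnion measurableSet_gridCell pairwise_disjoint_gridCell]
  refine (ENNReal.tsum_le_tsum fun z =>
    hM.lintegral_gridCell_le hs hε hK hl hεl hu hui z).trans ?_
  -- The products of each cell with itself are disjoint, so their `ν`-modulars add up to at most the
  -- full one.
  rw [ENNReal.tsum_mul_left, ← lintegral_iUnion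
    (fun z => (measurableSet_gridCell z).prod (measurableSet_gridCell z))
    (fun i j h => (pairwise_disjoint_gridCell h).set_prod_left _ _)]
  gcongr
  exact Measure.restrict_le_self

/-- On functions with bounded quotient `Dˢu`, grid averages approximate the identity uniformly. -/
lemma exists_modular_sub_gridAverage_le_one (hM : IsYoungFunction M) (hs : 0 < s) (n : ℕ)
    (hK : 0 < K) (hl : 0 < l) :
    ∃ m : ℕ, ∀ u : EuclideanSpace ℝ (Fin n) → ℝ, AEMeasurable u → Integrable u →
      modular M (nu n) (fun p => holderQuot s u p / K) ≤ 1 →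
        modular M volume (fun x => (u x - gridAverage (1 / ((m : ℝ) + 1)) u x) / l) ≤ 1 := by
  have h0 : Tendsto (fun m : ℕ => (√n * (1 / ((m : ℝ) + 1))) ^ s * K / l) atTop (𝓝 0) := by
    have h1 : Tendsto (fun m : ℕ => √n * (1 / ((m : ℝ) + 1))) atTop (𝓝 0) := by
      simpa using (tendsto_one_div_add_atTop_nhds_zero_nat (𝕜 := ℝ)).const_mul √n
    have h2 := h1.rpow_const (p := s) (Or.inr hs.le)
    rw [Real.zero_rpow hs.ne'] at h2
    simpa using (h2.mul_const K).div_const l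
  have h1 := h0.const_mul (√n ^ n)
  rw [mul_zero] at h1
  -- The first smallness condition lets the factor leave `M`; the second absorbs the constant `√n ^
  -- n`.
  obtain ⟨m, hm1, hm2⟩ := ((h0.eventually_le_const one_pos).and
    (h1.eventually_le_const one_pos)).exists
  refine ⟨m, fun u hu hui h => ?_⟩
  refine (hM.modular_sub_gridAverage_le hs (by positivity) hK hl hm1 hu
    fun z => hui.integrableOn).trans ?_
  exact mul_le_one' (ENNReal.ofReal_le_one.2 hm2) h

end IsYoungFunction

end FracOrlicz

namespace FracOrlicz

namespace IsYoungFunction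

variable {M : ℝ → ℝ}

/-! ### Convergence and completeness on spaces of finite measure. -/

section FiniteMeasure

variable {α : Type*} [MeasurableSpace α] {μ : Measure α} [IsFiniteMeasure μ]

/-- Bounded pointwise convergence implies norm convergence on spaces of finite measure. -/
lemma eventually_modular_sub_le_one (hM : IsYoungFunction M) {f : ℕ → α → ℝ} {w : α → ℝ}
    (hf : ∀ j, Measurable (f j)) {B : ℝ} (hB : ∀ j x, |f j x| ≤ B)
    (hw : ∀ x, Tendsto (fun j => f j x) atTop (𝓝 (w x))) {l : ℝ} :
    ∀ᶠ j in atTop, modular M μ (fun x => (f j x - w x) / l) ≤ 1 := by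
  have hwm : Measurable w := measurable_of_tendsto_metrizable hf (tendsto_pi_nhds.2 hw)
  have hwB : ∀ x, |w x| ≤ B := fun x => le_of_tendsto (hw x).abs (Eventually.of_forall fun j =>
    hB j x)
  have h : Tendsto (fun j => modular M μ (fun x => (f j x - w x) / l)) atTop
      (𝓝 (∫⁻ _, 0 ∂μ)) := by
    refine tendsto_lintegral_of_dominated_convergence
      (fun _ => ENNReal.ofReal (M ((B + B) / l))) (fun j => ?_) (fun j => ?_) ?_ ?_
    · exact (hM.continuous.measurable.comp (((hf j).sub hwm).div_const l)).ennreal_ofReal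
    · refine ae_of_all _ fun x => ENNReal.ofReal_le_ofReal (hM.mono_abs ?_)
      rw [abs_div, abs_div]
      refine div_le_div_of_nonneg_right ?_ (abs_nonneg l)
      exact (norm_sub_le (f j x) (w x)).trans
        ((add_le_add (hB j x) (hwB x)).trans (le_abs_self _))
    · rw [lintegral_const]
      exact ENNReal.mul_ne_top ENNReal.ofReal_ne_top (measure_ne_top _ _)
    · refine ae_of_all _ fun x => ?_
      have h1 : Tendsto (fun j => (f j x - w x) / l) atTop (𝓝 0) := by
        simpa using ((hw x).sub_const (w x)).div_const l
      have h2 := ENNReal.tendsto_ofReal ((hM.continuous.tendsto 0).comp h1)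
      simpa [hM.map_zero] using h2
  rw [lintegral_zero] at h
  exact h.eventually_le_const one_pos

/-- On finite measure the `L¹` norm is at most a fixed multiple of any scale `l` at which the
modular is at most 1. -/
lemma cauchySeq_toL1 (hM : IsYoungFunction M) {w : ℕ → α → ℝ} (hi : ∀ j, Integrable (w j) μ)
    (hc : ∀ l : ℝ, 0 < l → ∃ N : ℕ, ∀ i ≥ N, ∀ j ≥ N,
      modular M μ (fun x => (w i x - w j x) / l) ≤ 1) :
    CauchySeq fun j => (hi j).toL1 (w j) := by
  obtain ⟨T, hT0, hT⟩ := hM.exists_abs_le_add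
  refine EMetric.cauchySeq_iff.2 fun ε hε => ?_
  obtain ⟨l, hl, hlε⟩ := ENNReal.exists_nnreal_pos_mul_lt
    (a := ENNReal.ofReal T * μ univ + 1)
    (ENNReal.add_ne_top.2 ⟨ENNReal.mul_ne_top ENNReal.ofReal_ne_top (measure_ne_top _ _),
      ENNReal.one_ne_top⟩) hε.ne'
  obtain ⟨N, hN⟩ := hc l hl
  refine ⟨N, fun i hi' j hj => ?_⟩
  rw [Integrable.edist_toL1_toL1]
  refine lt_of_le_of_lt ?_ hlε
  have := hM.lintegral_enorm_le hT0 hT (NNReal.coe_pos.2 hl) (hN i hi' j hj)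
  simpa only [edist_eq_enorm_sub, ENNReal.ofReal_coe_nnreal] using this

/-- Completeness of `L_M(μ)` for finite `μ`. -/
lemma exists_limit (hM : IsYoungFunction M) {w : ℕ → α → ℝ} (hw : ∀ j, MemL M μ (w j))
    (hc : ∀ l : ℝ, 0 < l → ∃ N : ℕ, ∀ i ≥ N, ∀ j ≥ N,
      modular M μ (fun x => (w i x - w j x) / l) ≤ 1) :
    ∃ v : α → ℝ, MemL M μ v ∧ ∀ l : ℝ, 0 < l → ∃ N : ℕ, ∀ i ≥ N,
      modular M μ (fun x => (w i x - v x) / l) ≤ 1 := by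
  have hi : ∀ j, Integrable (w j) μ := fun j => hM.integrable_of_memL (hw j)
  obtain ⟨F, hF⟩ := cauchySeq_tendsto_of_complete (hM.cauchySeq_toL1 hi hc)
  obtain ⟨ψ, hψ, hae⟩ := (tendstoInMeasure_of_tendsto_Lp hF).exists_seq_tendsto_ae
  have hF : AEMeasurable (F : α → ℝ) μ := (Lp.aestronglyMeasurable F).aemeasurable
  have hlim : ∀ᵐ x ∂μ, Tendsto (fun i => w (ψ i) x) atTop (𝓝 (F x)) := by
    filter_upwards [hae, ae_all_iff.2 fun i => (hi (ψ i)).coeFn_toL1] with x hx h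
    simpa only [h] using hx
  have key : ∀ l : ℝ, 0 < l → ∃ N : ℕ, ∀ i ≥ N,
      modular M μ (fun x => (w i x - F x) / l) ≤ 1 := fun l hl => by
    obtain ⟨N, hN⟩ := hc l hl
    refine ⟨N, fun i hiN => ?_⟩
    -- Fatou's lemma along the a.e. convergent subsequence `ψ` transfers the Cauchy bound to the
    -- limit.
    calc modular M μ (fun x => (w i x - F x) / l)
        = ∫⁻ x, liminf (fun k => ENNReal.ofReal (M ((w i x - w (ψ k) x) / l))) atTop ∂μ := by
          refine lintegral_congr_ae ?_
          filter_upwards [hlim] with x hx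
          refine (Tendsto.liminf_eq ?_).symm
          exact ENNReal.tendsto_ofReal
            ((hM.continuous.tendsto _).comp ((hx.const_sub (w i x)).div_const l))
      _ ≤ liminf (fun k => modular M μ (fun x => (w i x - w (ψ k) x) / l)) atTop :=
          lintegral_liminf_le' fun k =>
            hM.aemeasurable_comp (((hw i).1.sub (hw (ψ k)).1).div_const l)
      _ ≤ 1 := by
          refine (liminf_le_liminf (v := fun _ => (1 : ℝ≥0∞)) ?_).trans_eq (liminf_const _)
          filter_upwards [eventually_ge_atTop N] with k hk
          exact hN i hiN (ψ k) (hk.trans (hψ.id_le k))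
  refine ⟨F, ⟨hF, ?_⟩, key⟩
  obtain ⟨N, hN⟩ := key 1 one_pos
  obtain ⟨k, hk, h⟩ := hM.exists_modular_le_one (hw N)
  -- The limit is `w N - (w N - F)`, with the two terms controlled at scales `k` and `1`.
  refine ⟨k + 1, by positivity, lt_of_le_of_lt ?_ ENNReal.one_lt_top⟩
  simpa using hM.modular_sub_le_one (hw N).1 hk one_pos h (hN N le_rfl)

end FiniteMeasure

/-- Over a bounded set of finite measure, approximants need only be bounded: multiplying by the
indicator of `S` fixes their support without changing them on `S`. -/
lemma memE_restrict {α : Type*} [MeasurableSpace α] [Bornology α] {μ : Measure α} {S : Set α}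
    (hS : MeasurableSet S) (hSb : Bornology.IsBounded S) (hSμ : μ S < ∞) {f : α → ℝ}
    (hf : MemL M (μ.restrict S) f)
    (h : ∀ l : ℝ, 0 < l → ∃ g : α → ℝ, Measurable g ∧ (∃ C : ℝ, ∀ x, |g x| ≤ C) ∧
      modular M (μ.restrict S) (fun x => (f x - g x) / l) ≤ 1) :
    MemE M (μ.restrict S) f := by
  refine ⟨hf, fun ε hε => ?_⟩
  obtain ⟨g, hg, ⟨C, hC⟩, hm⟩ := h (ε / 2) (by positivity)
  refine ⟨S.indicator g, (hg.indicator hS).aemeasurable, ⟨C, fun x => ?_⟩,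
    hSb.subset support_indicator_subset, ?_, ?_⟩
  · by_cases hx : x ∈ S
    · simpa [hx] using hC x
    · simpa [hx] using (abs_nonneg _).trans (hC x)
  · exact (measure_mono support_indicator_subset).trans_lt
      ((Measure.restrict_apply_self μ S).trans_lt hSμ)
  · refine lt_of_le_of_lt (luxNorm_le (by positivity) ?_) (half_lt_self hε)
    refine (modular_congr_ae ?_).trans_le hm
    filter_upwards [ae_restrict_mem hS] with x hx
    rw [indicator_of_mem hx]

end IsYoungFunction

/-! ### Bounded approximation and compactness in `W₀ˢL_M(Ω)`. -/

section Compactness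

variable {n : ℕ} {s : ℝ} {M : ℝ → ℝ} {Ω : TopologicalSpace.Opens (EuclideanSpace ℝ (Fin n))}
  {u : EuclideanSpace ℝ (Fin n) → ℝ}

lemma integrable_of_mem_W0L (hM : IsYoungFunction M)
    (hΩ : Bornology.IsBounded (Ω : Set (EuclideanSpace ℝ (Fin n)))) (hu : u ∈ W0L s M Ω) :
    Integrable u :=
  (hM.integrableOn_of_memL (mem_WL_of_mem_W0L hu).1
    hΩ.measure_lt_top.ne).integrable_of_ae_notMem_eq_zero (ae_eq_zero_of_mem_W0L hM hu)

/-- Elements of `W₀ˢL_M(Ω)` are approximated in norm by bounded functions. -/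
lemma exists_bounded_approx (hM : IsYoungFunction M) (hs : 0 < s)
    (hΩ : Bornology.IsBounded (Ω : Set (EuclideanSpace ℝ (Fin n)))) (hu : u ∈ W0L s M Ω)
    {l : ℝ} (hl : 0 < l) :
    ∃ g : EuclideanSpace ℝ (Fin n) → ℝ, Measurable g ∧ (∃ C : ℝ, ∀ x, |g x| ≤ C) ∧
      modular M (volume.restrict Ω) (fun x => (u x - g x) / l) ≤ 1 := by
  obtain ⟨huL, huD⟩ := mem_WL_of_mem_W0L hu
  have hui := integrable_of_mem_W0L hM hΩ hu
  obtain ⟨K, hK, hKu⟩ := hM.exists_modular_le_one huD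
  obtain ⟨m, hm⟩ := hM.exists_modular_sub_gridAverage_le_one hs n hK hl
  exact ⟨gridAverage (1 / ((m : ℝ) + 1)) u, measurable_gridAverage u,
    ⟨_, abs_gridAverage_le (by positivity) hui⟩,
    (modular_restrict_le _).trans (hm u huL.1 hui hKu)⟩

lemma memE_of_mem_W0L (hM : IsYoungFunction M) (hs : 0 < s)
    (hΩ : Bornology.IsBounded (Ω : Set (EuclideanSpace ℝ (Fin n)))) (hu : u ∈ W0L s M Ω) :
    MemE M (volume.restrict (Ω : Set (EuclideanSpace ℝ (Fin n)))) u :=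
  IsYoungFunction.memE_restrict Ω.isOpen.measurableSet hΩ hΩ.measure_lt_top
    ((mem_WL_of_mem_W0L hu).1.restrict _) fun _ hl => exists_bounded_approx hM hs hΩ hu hl

/-- Bounded subsets of `W₀ˢL_M(Ω)` are bounded in `L¹`. -/
lemma exists_integral_abs_le (hM : IsYoungFunction M)
    (hΩ : Bornology.IsBounded (Ω : Set (EuclideanSpace ℝ (Fin n)))) {K : ℝ} (hK : 0 < K) :
    ∃ B : ℝ, ∀ u ∈ W0L s M Ω, modular M (volume.restrict Ω) (fun x => u x / K) ≤ 1 →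
      ∫ x, |u x| ≤ B := by
  obtain ⟨T, hT0, hT⟩ := hM.exists_abs_le_add
  have hfin : volume.restrict (Ω : Set (EuclideanSpace ℝ (Fin n))) univ ≠ ∞ := by
    simpa using hΩ.measure_lt_top.ne
  refine ⟨(ENNReal.ofReal K * (ENNReal.ofReal T *
    volume.restrict (Ω : Set (EuclideanSpace ℝ (Fin n))) univ + 1)).toReal, fun u hu h => ?_⟩
  have h0 := ae_eq_zero_of_mem_W0L hM hu
  have h1 : ∫ x, |u x| = ∫ x in (Ω : Set (EuclideanSpace ℝ (Fin n))), |u x| :=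
    (setIntegral_eq_integral_of_ae_compl_eq_zero
      (h0.mono fun x hx hxΩ => by rw [hx hxΩ, abs_zero])).symm
  have h2 := integral_norm_eq_lintegral_enorm
    (integrable_of_mem_W0L hM hΩ hu).integrableOn.aestronglyMeasurable
    (μ := volume.restrict (Ω : Set (EuclideanSpace ℝ (Fin n))))
  simp only [Real.norm_eq_abs] at h2
  rw [h1, h2]
  refine ENNReal.toReal_mono ?_ (hM.lintegral_enorm_le hT0 hT hK h)
  exact ENNReal.mul_ne_top ENNReal.ofReal_ne_top
    (ENNReal.add_ne_top.2 ⟨ENNReal.mul_ne_top ENNReal.ofReal_ne_top hfin, ENNReal.one_ne_top⟩)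

/-- A sequence bounded in `L¹` has a subsequence whose averages on all cells of all the grids
`(m + 1)⁻¹ ℤⁿ` converge. -/
lemma exists_subseq_tendsto_gridAverage {u : ℕ → EuclideanSpace ℝ (Fin n) → ℝ}
    (hu : ∀ k, Integrable (u k)) {B : ℝ} (hB : ∀ k, ∫ x, |u k x| ≤ B) :
    ∃ φ : ℕ → ℕ, StrictMono φ ∧ ∃ w : ℕ → EuclideanSpace ℝ (Fin n) → ℝ, ∀ (m : ℕ) x,
      Tendsto (fun j => gridAverage (1 / ((m : ℝ) + 1)) (u (φ j)) x) atTop (𝓝 (w m x)) := by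
  set a : ℕ → ℕ × (Fin n → ℤ) → ℝ := fun k p => ⨍ y in gridCell (1 / ((p.1 : ℝ) + 1)) p.2, u k y
  set b : ℕ → ℝ := fun m => ((1 / ((m : ℝ) + 1)) ^ n)⁻¹ * B
  -- Pairs of a grid and a cell are countable, so this product of intervals is sequentially compact;
  -- this replaces an explicit diagonal extraction.
  have hK : IsCompact (univ.pi fun p : ℕ × (Fin n → ℤ) => Icc (-b p.1) (b p.1)) :=
    isCompact_univ_pi fun _ => isCompact_Icc
  obtain ⟨c, -, φ, hφ, hc⟩ := hK.tendsto_subseq (x := a) fun k p _ => by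
    refine abs_le.1 ((abs_setAverage_gridCell_le (by positivity) (hu k) p.2).trans ?_)
    exact mul_le_mul_of_nonneg_left (hB k) (by positivity)
  exact ⟨φ, hφ, fun m x => c (m, gridIndex (1 / ((m : ℝ) + 1)) x), fun m x =>
    tendsto_pi_nhds.1 hc (m, gridIndex (1 / ((m : ℝ) + 1)) x)⟩

/-- Sequences bounded in `W₀ˢL_M(Ω)` have subsequences that are Cauchy in `L_M(Ω)`. -/
lemma exists_cauchy_subseq (hM : IsYoungFunction M) (hs : 0 < s)
    (hΩ : Bornology.IsBounded (Ω : Set (EuclideanSpace ℝ (Fin n))))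
    {u : ℕ → EuclideanSpace ℝ (Fin n) → ℝ} (hu : ∀ k, u k ∈ W0L s M Ω) {K : ℝ} (hK : 0 < K)
    (hKu : ∀ k, modular M (volume.restrict Ω) (fun x => u k x / K) ≤ 1)
    (hKD : ∀ k, modular M (nu n) (fun p => holderQuot s (u k) p / K) ≤ 1) :
    ∃ φ : ℕ → ℕ, StrictMono φ ∧ ∀ l : ℝ, 0 < l → ∃ N : ℕ, ∀ i ≥ N, ∀ j ≥ N,
      modular M (volume.restrict Ω) (fun x => (u (φ i) x - u (φ j) x) / l) ≤ 1 := by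
  have hfin : IsFiniteMeasure (volume.restrict (Ω : Set (EuclideanSpace ℝ (Fin n)))) :=
    ⟨by simpa using hΩ.measure_lt_top⟩
  have hui : ∀ k, Integrable (u k) := fun k => integrable_of_mem_W0L hM hΩ (hu k)
  obtain ⟨B, hB⟩ := exists_integral_abs_le (s := s) hM hΩ hK
  obtain ⟨φ, hφ, w, hw⟩ := exists_subseq_tendsto_gridAverage hui fun k => hB _ (hu k) (hKu k)
  refine ⟨φ, hφ, fun l hl => ?_⟩
  -- Four errors of scale `l / 4`: for each of the two indices, `u` to its average and the average
  -- to its limit `w m`.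
  obtain ⟨m, hm⟩ := hM.exists_modular_sub_gridAverage_le_one hs n hK (l := l / 4) (by positivity)
  have hwm : Measurable (w m) := measurable_of_tendsto_metrizable
    (fun j => measurable_gridAverage (u (φ j))) (tendsto_pi_nhds.2 (hw m))
  obtain ⟨N, hN⟩ := eventually_atTop.1 (hM.eventually_modular_sub_le_one
    (μ := volume.restrict (Ω : Set (EuclideanSpace ℝ (Fin n)))) (l := l / 4)
    (fun j => measurable_gridAverage (u (φ j)))
    (fun j x => (abs_gridAverage_le (by positivity) (hui (φ j)) x).trans
      (mul_le_mul_of_nonneg_left (hB _ (hu (φ j)) (hKu (φ j))) (by positivity)))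
    (hw m))
  have key : ∀ j ≥ N,
      modular M (volume.restrict Ω) (fun x => (u (φ j) x - w m x) / (l / 2)) ≤ 1 := by
    intro j hj
    have h := hM.modular_add_le_one
      ((hui (φ j)).aemeasurable.sub (measurable_gridAverage (u (φ j))).aemeasurable).restrict
      (by positivity) (by positivity)
      ((modular_restrict_le _).trans (hm _ (hui (φ j)).aemeasurable (hui (φ j)) (hKD (φ j))))
      (hN j hj)
    refine le_of_eq_of_le ?_ h
    congr 1 with x
    simp only [Pi.sub_apply]
    ring
  refine ⟨N, fun i hi j hj => ?_⟩
  have h := hM.modular_sub_le_one ((hui (φ i)).aemeasurable.sub hwm.aemeasurable).restrict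
    (by positivity) (by positivity) (key i hi) (key j hj)
  refine le_of_eq_of_le ?_ h
  congr 1 with x
  simp only [Pi.sub_apply]
  ring

end Compactness

end FracOrlicz

/-! ### The compact inclusion. -/

theorem theoremB3 {n : ℕ} (hn : 1 ≤ n) {s : ℝ} (hs0 : 0 < s) (hs1 : s < 1)
    {M : ℝ → ℝ} (hM : FracOrlicz.IsYoungFunction M)
    (Ω : TopologicalSpace.Opens (EuclideanSpace ℝ (Fin n)))
    (hΩ : Bornology.IsBounded (Ω : Set (EuclideanSpace ℝ (Fin n))))
    (hseg : FracOrlicz.SegmentProperty (Ω : Set (EuclideanSpace ℝ (Fin n)))) :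
    (∀ u ∈ FracOrlicz.W0L s M Ω,
      FracOrlicz.MemE M (volume.restrict (Ω : Set (EuclideanSpace ℝ (Fin n)))) u) ∧
    ∀ u : ℕ → EuclideanSpace ℝ (Fin n) → ℝ,
      (∀ k, u k ∈ FracOrlicz.W0L s M Ω) →
      (∃ C : ℝ, ∀ k, FracOrlicz.normW0 s M Ω (u k) ≤ C) →
      ∃ v : EuclideanSpace ℝ (Fin n) → ℝ,
        FracOrlicz.MemE M (volume.restrict (Ω : Set (EuclideanSpace ℝ (Fin n)))) v ∧
        ∃ φ : ℕ → ℕ, StrictMono φ ∧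
          Tendsto (fun j => FracOrlicz.luxNorm M
            (volume.restrict (Ω : Set (EuclideanSpace ℝ (Fin n)))) (fun x => u (φ j) x - v x))
            atTop (𝓝 0) := by

  refine ⟨fun u hu => FracOrlicz.memE_of_mem_W0L hM hs0 hΩ hu, fun u hu ⟨C, hC⟩ => ?_⟩
  have hC0 : 0 ≤ C :=
    (add_nonneg FracOrlicz.luxNorm_nonneg FracOrlicz.luxNorm_nonneg).trans (hC 0)
  have hfin : IsFiniteMeasure (volume.restrict (Ω : Set (EuclideanSpace ℝ (Fin n)))) :=
    ⟨by simpa using hΩ.measure_lt_top⟩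
  have hL : ∀ k, FracOrlicz.MemL M (volume.restrict (Ω : Set (EuclideanSpace ℝ (Fin n)))) (u k) :=
    fun k => (FracOrlicz.mem_WL_of_mem_W0L (hu k)).1.restrict _
  -- The scale `C + 1` lies strictly above both norms, so the modulars are at most 1 without knowing
  -- that the infimum is attained.
  obtain ⟨φ, hφ, hc⟩ := FracOrlicz.exists_cauchy_subseq hM hs0 hΩ hu (K := C + 1) (by positivity)
    (fun k => hM.modular_le_one_of_luxNorm_lt (hL k) <|
      ((le_add_of_nonneg_right FracOrlicz.luxNorm_nonneg).trans (hC k)).trans_lt (lt_add_one C))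
    (fun k => hM.modular_le_one_of_luxNorm_lt (FracOrlicz.mem_WL_of_mem_W0L (hu k)).2 <|
      ((le_add_of_nonneg_left FracOrlicz.luxNorm_nonneg).trans (hC k)).trans_lt (lt_add_one C))
  obtain ⟨v, hv, hlim⟩ := hM.exists_limit (fun j => hL (φ j)) hc
  refine ⟨v, FracOrlicz.IsYoungFunction.memE_restrict Ω.isOpen.measurableSet hΩ hΩ.measure_lt_top
    hv fun l hl => ?_, φ, hφ, ?_⟩
  -- The limit inherits bounded approximants from a late term of the subsequence.
  · obtain ⟨N, hN⟩ := hlim (l / 2) (by positivity)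
    obtain ⟨g, hg, hgb, hgm⟩ := FracOrlicz.exists_bounded_approx hM hs0 hΩ (hu (φ N))
      (l := l / 2) (by positivity)
    refine ⟨g, hg, hgb, ?_⟩
    have h := hM.modular_sub_le_one ((hL (φ N)).1.sub hg.aemeasurable) (by positivity)
      (by positivity) hgm (hN N le_rfl)
    refine le_of_eq_of_le ?_ h
    congr 1 with x
    simp only [Pi.sub_apply]
    ring
  · refine tendsto_order.2 ⟨fun b hb => Eventually.of_forall fun j =>
      hb.trans_le FracOrlicz.luxNorm_nonneg, fun b hb => ?_⟩
    obtain ⟨N, hN⟩ := hlim (b / 2) (by positivity)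
    filter_upwards [eventually_ge_atTop N] with j hj
    exact (FracOrlicz.luxNorm_le (by positivity) (hN j hj)).trans_lt (half_lt_self hb)
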